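/- All graphs are finite, simple and undirected. A \emph{convex drawing} of a graph $G$ represents the vertices of $G$ by distinct points on a circle in the plane and each edge by the straight line-segment between its endpoints, such that no three edges meet in a point other than a common endpoint. Two distinct edges \emph{cross} if they have a common point that is not a common endpoint. A \emph{strong tree decomposition} of $G$ consists of a finite tree $T$ and a set $B_i\subseteq V(G)$ (a \emph{bag}) for each node $i$ of $T$, such that for every vertex $v$ of $G$ the nodes $i$ with $v\in B_i$ induce a nonempty connected subgraph of $T$, and for every edge $vw$ of $G$ some bag contains both $v$ and $w$; its \emph{width} is $\max_i|B_i|$. The \emph{tree-width} of $G$ is $1$ less than the minimum width of a strong tree decomposition of $G$. Let $k\geq 0$ be an integer. Suppose that a graph $G$ has a convex drawing such that whenever two edges $e$ and $f$ cross, $e$ crosses at most $k$ edges or $f$ crosses at most $k$ edges. Then $G$ has tree-width at most $3k+11$. -/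

import Mathlib

/-- The Euclidean plane. -/
abbrev Plane : Type := EuclideanSpace ℝ (Fin 2)

/-- The straight line-segment joining the images of the two ends of `e`. -/
def edgeSegment {V : Type*} (pos : V → Plane) (e : Sym2 V) : Set Plane :=
  Sym2.lift ⟨fun u v => segment ℝ (pos u) (pos v), fun u v => segment_symm ℝ (pos u) (pos v)⟩ e

/-- A rectilinear drawing of `G` in the plane: distinct vertices are distinct points, each edge is
the line-segment between its ends, the only vertices an edge meets are its own ends, and no three
edges meet in a point, except at a common end. -/
structure RectilinearDrawing {V : Type*} (G : SimpleGraph V) where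
  pos : V → Plane
  injective : Function.Injective pos
  vertex_mem : ∀ e ∈ G.edgeSet, ∀ v : V, pos v ∈ edgeSegment pos e → v ∈ e
  no_three : ∀ e ∈ G.edgeSet, ∀ f ∈ G.edgeSet, ∀ g ∈ G.edgeSet, e ≠ f → f ≠ g → e ≠ g →
    ∀ x ∈ edgeSegment pos e ∩ edgeSegment pos f ∩ edgeSegment pos g,
      ∃ v : V, v ∈ e ∧ v ∈ f ∧ v ∈ g ∧ x = pos v

namespace RectilinearDrawing

variable {V : Type*} {G : SimpleGraph V}

/-- The drawing is convex: all vertices lie on a common circle. -/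
def IsConvex (Γ : RectilinearDrawing G) : Prop :=
  EuclideanGeometry.Cospherical (Set.range Γ.pos)

/-- Two distinct edges cross if they meet in a point that is not a common end of them. -/
def Crosses (Γ : RectilinearDrawing G) (e f : Sym2 V) : Prop :=
  e ∈ G.edgeSet ∧ f ∈ G.edgeSet ∧ e ≠ f ∧
    ∃ x ∈ edgeSegment Γ.pos e ∩ edgeSegment Γ.pos f, ∀ v : V, v ∈ e → v ∈ f → x ≠ Γ.pos v

/-- The set of edges that are crossed by `e`. -/
def crossedEdges (Γ : RectilinearDrawing G) (e : Sym2 V) : Set (Sym2 V) :=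
  {f | Γ.Crosses e f}

end RectilinearDrawing

/-- A decomposition of `G` indexed by the graph `D`: every node `i` of `D` carries a bag of vertices
of `G`, the nodes whose bags contain a given vertex induce a connected nonempty subgraph of `D`,
and for adjacent vertices of `G` these subgraphs share a node or are joined by an edge of `D`. -/
structure GraphDecomposition {V ι : Type*} (G : SimpleGraph V) (D : SimpleGraph ι) where
  bag : ι → Finset V
  connected : ∀ v : V, (D.induce {i | v ∈ bag i}).Connected
  touch : ∀ v w : V, G.Adj v w → ∃ i j : ι, v ∈ bag i ∧ w ∈ bag j ∧ (i = j ∨ D.Adj i j)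

namespace GraphDecomposition

variable {V ι : Type*} {G : SimpleGraph V} {D : SimpleGraph ι}

/-- A decomposition is strong if the two ends of each edge of `G` lie in a common bag. -/
def IsStrong (X : GraphDecomposition G D) : Prop :=
  ∀ v w : V, G.Adj v w → ∃ i : ι, v ∈ X.bag i ∧ w ∈ X.bag i

/-- The width of a decomposition is the maximum cardinality of a bag. -/
def width [Fintype ι] (X : GraphDecomposition G D) : ℕ :=
  Finset.univ.sup fun i => (X.bag i).card

end GraphDecomposition

/-- The widths of the strong tree decompositions of `G`. Every finite tree is isomorphic to one
whose nodes are `0, …, n - 1`. -/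
def strongTreeWidths {V : Type*} (G : SimpleGraph V) : Set ℕ :=
  {m | ∃ (n : ℕ) (T : SimpleGraph (Fin n)) (X : GraphDecomposition G T),
    T.IsTree ∧ X.IsStrong ∧ X.width = m}

/-- The tree-width of `G` is one less than the minimum width of a strong tree decomposition. It is
an integer because the graph without vertices has tree-width `-1`. -/
noncomputable def treeWidth {V : Type*} (G : SimpleGraph V) : ℤ :=
  ((sInf (strongTreeWidths G) : ℕ) : ℤ) - 1

/-- The minimum in the definition of tree-width is taken over a nonempty set. -/
theorem strongTreeWidths_nonempty {V : Type*} [Finite V] (G : SimpleGraph V) :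
    (strongTreeWidths G).Nonempty := by
  have := Fintype.ofFinite V
  refine ⟨_, 1, ⊥, ⟨fun _ => Finset.univ, fun v => ?_, fun v w _ => ?_⟩, ?_, ?_, rfl⟩
  · have : Nonempty ({i : Fin 1 | v ∈ (Finset.univ : Finset V)}) := ⟨⟨0, by simp⟩⟩
    exact ⟨fun a b => by rw [Subsingleton.elim a b]⟩
  · exact ⟨0, 0, by simp⟩
  · exact ⟨⟨fun a b => by rw [Subsingleton.elim a b]⟩, SimpleGraph.isAcyclic_bot⟩
  · exact fun v w _ => ⟨0, by simp⟩

/-! Number the vertices in their counterclockwise order, so that two edges cross when their ends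
interleave. The vertices between `a` and `b` are separated from the others by `a`, `b` and one end
of each edge crossing the chord `ab`. If at most `2k` edges cross `ab` and some vertex lies strictly
between `a` and `b`, then there is such a vertex `c` for which at most `k` further edges separate
`c` from `ab`, while `ac` and `cb` are again crossed by at most `2k` edges each. The triangle `acb`
then yields a bag of at most `2k + k + 3` vertices that contains the separators of `ac` and `cb`,
and the decompositions obtained recursively for these two chords are glued to it. Starting from the
chord between the first and the last vertex, which no edge crosses, one decomposes `G`.

To find `c` when `ab` is crossed, let `p` be the median of the ends between `a` and `b` of the edges
crossing `ab`, so that at most `k` of these edges cross `ap` and at most `k` cross `pb`. If at most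
`k` edges separate `p` from `ab`, take `c = p`. Otherwise each of them crosses an edge of `G` that
ends at `p` and is crossed more than `k` times, so each is itself crossed at most `k` times; an
extremal one among them has an end that serves as `c`. -/

section TreeDecomposition

open scoped Finset

variable {V ι κ : Type*} {G : SimpleGraph V} {U U' : Set V} {T : SimpleGraph ι}
  {T' : SimpleGraph κ} {bag : ι → Finset V} {bag' : κ → Finset V}

theorem isTree_sum_sup_edge [Finite ι] [Finite κ] (hT : T.IsTree) (hT' : T'.IsTree) (r : ι)
    (r' : κ) : (T.sum T' ⊔ SimpleGraph.edge (.inl r) (.inr r')).IsTree := by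
  classical
  cases nonempty_fintype ι
  cases nonempty_fintype κ
  rw [SimpleGraph.isTree_iff_connected_and_card] at hT hT' ⊢
  refine ⟨hT.1.sum_sup_edge hT'.1, ?_⟩
  have hsum : Nat.card (T.sum T').edgeSet = Nat.card T.edgeSet + Nat.card T'.edgeSet := by
    rw [Nat.card_congr SimpleGraph.edgeSetSumEquiv, Nat.card_sum]
  have hedge := SimpleGraph.card_edgeFinset_sup_edge _
    (SimpleGraph.not_adj_sum_inl_inr (G := T) (H := T') r r') Sum.inl_ne_inr
  simp only [SimpleGraph.edgeFinset_card, ← Nat.card_eq_fintype_card] at hedge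
  rw [hedge, hsum, Nat.card_sum, ← hT.2, ← hT'.2]
  ring

theorem connected_induce_image {s : Set ι} (f : T →g T') (hs : (T.induce s).Connected) :
    (T'.induce (f '' s)).Connected :=
  hs.map ⟨fun i => ⟨f i.1, Set.mem_image_of_mem f i.2⟩, fun h => f.map_adj h⟩
    (by rintro ⟨_, i, hi, rfl⟩; exact ⟨⟨i, hi⟩, rfl⟩)

/-- A tree decomposition of the subgraph of `G` induced by `U`, with bag `bag i` at the node `i` of
`T`. The bags are sets of vertices of `G` rather than of the induced subgraph, so that
decompositions over different sets `U` can be glued. -/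
structure IsTreeDecompositionOn (G : SimpleGraph V) (U : Set V) (T : SimpleGraph ι)
    (bag : ι → Finset V) : Prop where
  isTree : T.IsTree
  bag_subset : ∀ i, ↑(bag i) ⊆ U
  connected : ∀ v ∈ U, (T.induce {i | v ∈ bag i}).Connected
  exists_bag : ∀ u ∈ U, ∀ v ∈ U, G.Adj u v → ∃ i, u ∈ bag i ∧ v ∈ bag i

namespace IsTreeDecompositionOn

theorem singleton (G : SimpleGraph V) (B : Finset V) :
    IsTreeDecompositionOn G B (⊥ : SimpleGraph Unit) fun _ => B where
  isTree := .of_subsingleton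
  bag_subset _ := subset_rfl
  connected v hv :=
    have : Nonempty {_i : Unit | v ∈ B} := ⟨⟨(), hv⟩⟩
    .of_subsingleton
  exists_bag _ hu _ hv _ := ⟨(), hu, hv⟩

theorem setOf_mem_bag_eq_empty (h : IsTreeDecompositionOn G U T bag) {v : V} (hv : v ∉ U) :
    {i | v ∈ bag i} = ∅ :=
  Set.eq_empty_of_forall_notMem fun i hi => hv (h.bag_subset i hi)

theorem glue [Finite ι] [Finite κ] (h : IsTreeDecompositionOn G U T bag)
    (h' : IsTreeDecompositionOn G U' T' bag') {r : ι} {r' : κ}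
    (hr : U ∩ U' ⊆ bag r) (hr' : U ∩ U' ⊆ bag' r')
    (hsep : ∀ u ∈ U \ U', ∀ v ∈ U' \ U, ¬G.Adj u v) :
    IsTreeDecompositionOn G (U ∪ U') (T.sum T' ⊔ SimpleGraph.edge (.inl r) (.inr r'))
      (Sum.elim bag bag') where
  isTree := isTree_sum_sup_edge h.isTree h'.isTree r r'
  bag_subset := by
    rintro (i | j)
    · exact (h.bag_subset i).trans Set.subset_union_left
    · exact (h'.bag_subset j).trans Set.subset_union_right
  connected v hv := by
    have hnodes : {i | v ∈ Sum.elim bag bag' i} =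
        Sum.inl '' {i | v ∈ bag i} ∪ Sum.inr '' {j | v ∈ bag' j} := by
      ext (i | j) <;> simp
    let inl : T →g T.sum T' ⊔ SimpleGraph.edge (.inl r) (.inr r') :=
      (SimpleGraph.Hom.ofLE le_sup_left).comp SimpleGraph.Embedding.sumInl.toHom
    let inr : T' →g T.sum T' ⊔ SimpleGraph.edge (.inl r) (.inr r') :=
      (SimpleGraph.Hom.ofLE le_sup_left).comp SimpleGraph.Embedding.sumInr.toHom
    have hinl := fun hU => connected_induce_image inl (h.connected v hU)
    have hinr := fun hU' => connected_induce_image inr (h'.connected v hU')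
    rw [hnodes]
    by_cases hU : v ∈ U <;> by_cases hU' : v ∈ U'
    · exact SimpleGraph.connected_induce_union (hinl hU).preconnected (hinr hU').preconnected
        ⟨r, hr ⟨hU, hU'⟩, rfl⟩ ⟨r', hr' ⟨hU, hU'⟩, rfl⟩ (.inr (by simp [SimpleGraph.edge_adj]))
    · rw [h'.setOf_mem_bag_eq_empty hU', Set.image_empty, Set.union_empty]
      exact hinl hU
    · rw [h.setOf_mem_bag_eq_empty hU, Set.image_empty, Set.empty_union]
      exact hinr hU'
    · exact (hv.elim hU hU').elim
  exists_bag u hu v hv huv := by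
    have hboth : u ∈ U ∧ v ∈ U ∨ u ∈ U' ∧ v ∈ U' := by
      grind [SimpleGraph.Adj.symm]
    rcases hboth with ⟨hu, hv⟩ | ⟨hu, hv⟩
    · obtain ⟨i, hi⟩ := h.exists_bag u hu v hv huv
      exact ⟨.inl i, hi⟩
    · obtain ⟨j, hj⟩ := h'.exists_bag u hu v hv huv
      exact ⟨.inr j, hj⟩

theorem comap (h : IsTreeDecompositionOn G U T bag) (e : κ ≃ ι) :
    IsTreeDecompositionOn G U (T.comap e) (bag ∘ e) where
  isTree := (SimpleGraph.Iso.comap e T).isTree_iff.2 h.isTree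
  bag_subset j := h.bag_subset (e j)
  connected v hv := by
    have hnodes : {j | v ∈ (bag ∘ e) j} =
        (SimpleGraph.Iso.comap e T).symm.toHom '' {i | v ∈ bag i} :=
      (e.symm.image_eq_preimage_symm {i | v ∈ bag i}).symm
    rw [hnodes]
    exact connected_induce_image _ (h.connected v hv)
  exists_bag u hu v hv huv := by
    obtain ⟨i, hi⟩ := h.exists_bag u hu v hv huv
    exact ⟨e.symm i, by simpa using hi⟩

theorem treeWidth_le [Finite ι] (h : IsTreeDecompositionOn G Set.univ T bag) {w : ℕ}
    (hw : ∀ i, #(bag i) ≤ w + 1) : treeWidth G ≤ w := by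
  obtain ⟨n, ⟨e⟩⟩ := Finite.exists_equiv_fin ι
  have h' := h.comap e.symm
  have hstrong : ∀ u v, G.Adj u v → ∃ i, u ∈ bag (e.symm i) ∧ v ∈ bag (e.symm i) :=
    fun u v => h'.exists_bag u trivial v trivial
  let X : GraphDecomposition G (T.comap e.symm) :=
    { bag := bag ∘ e.symm
      connected := fun v => h'.connected v trivial
      touch := fun u v huv =>
        let ⟨i, hu, hv⟩ := hstrong u v huv
        ⟨i, i, hu, hv, .inl rfl⟩ }
  have hX : X.width ≤ w + 1 := Finset.sup_le fun i _ => hw (e.symm i)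
  have hmin : sInf (strongTreeWidths G) ≤ X.width := Nat.sInf_le ⟨n, _, X, h'.isTree, hstrong, rfl⟩
  unfold treeWidth
  lia

end IsTreeDecompositionOn

/-- The subgraph of `G` induced by `U` has a tree decomposition into bags of at most `m` vertices,
one of which contains `R`. Decompositions are glued at these root bags. -/
def HasRootedTreeDecompositionOn (G : SimpleGraph V) (U : Set V) (R : Finset V) (m : ℕ) : Prop :=
  ∃ (ι : Type) (_ : Finite ι) (T : SimpleGraph ι) (bag : ι → Finset V),
    IsTreeDecompositionOn G U T bag ∧ (∀ i, #(bag i) ≤ m) ∧ ∃ r, R ⊆ bag r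

namespace HasRootedTreeDecompositionOn

variable {R R' : Finset V} {m : ℕ}

theorem of_card_le (G : SimpleGraph V) (hR : #R ≤ m) : HasRootedTreeDecompositionOn G R R m :=
  ⟨Unit, inferInstance, ⊥, fun _ => R, .singleton G R, fun _ => hR, (), subset_rfl⟩

theorem mono_root (h : HasRootedTreeDecompositionOn G U R m) (hR : R' ⊆ R) :
    HasRootedTreeDecompositionOn G U R' m :=
  let ⟨ι, hι, T, bag, hT, hm, r, hr⟩ := h
  ⟨ι, hι, T, bag, hT, hm, r, hR.trans hr⟩

theorem union (h : HasRootedTreeDecompositionOn G U R m)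
    (h' : HasRootedTreeDecompositionOn G U' R' m) (hR : U ∩ U' ⊆ R) (hR' : U ∩ U' ⊆ R')
    (hsep : ∀ u ∈ U \ U', ∀ v ∈ U' \ U, ¬G.Adj u v) :
    HasRootedTreeDecompositionOn G (U ∪ U') R m := by
  obtain ⟨ι, _, T, bag, hT, hm, r, hr⟩ := h
  obtain ⟨κ, _, T', bag', hT', hm', r', hr'⟩ := h'
  exact ⟨ι ⊕ κ, inferInstance, _, _, hT.glue hT' (hR.trans hr) (hR'.trans hr') hsep,
    Sum.rec hm hm', .inl r, hr⟩

theorem treeWidth_le (h : HasRootedTreeDecompositionOn G Set.univ R (m + 1)) :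
    treeWidth G ≤ m :=
  let ⟨_, _, _, _, hT, hm, _⟩ := h
  hT.treeWidth_le hm

end HasRootedTreeDecompositionOn

end TreeDecomposition

section ConvexDrawing

open scoped Finset

theorem exists_median {α β : Type*} [LinearOrder β] {s : Finset α} (hs : s.Nonempty) (f : α → β) :
    ∃ x ∈ s, 2 * #{y ∈ s | f y < f x} ≤ #s ∧ 2 * #{y ∈ s | f x < f y} ≤ #s := by
  obtain ⟨m, hm, hmin⟩ := s.exists_min_image f hs
  have hne : {x ∈ s | 2 * #{y ∈ s | f y < f x} ≤ #s}.Nonempty := by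
    have hm0 : {y ∈ s | f y < f m} = ∅ := Finset.filter_false_of_mem fun y hy => (hmin y hy).not_gt
    exact ⟨m, Finset.mem_filter.2 ⟨hm, by simp [hm0]⟩⟩
  obtain ⟨x, hx, hmax⟩ := Finset.exists_max_image _ f hne
  rw [Finset.mem_filter] at hx
  refine ⟨x, hx.1, hx.2, ?_⟩
  by_contra! hlt
  have habove : {y ∈ s | f x < f y}.Nonempty := Finset.card_pos.1 (by lia)
  obtain ⟨z, hz, hzmin⟩ := Finset.exists_min_image _ f habove
  have hbelow : {y ∈ s | f y < f z} ⊆ {y ∈ s | ¬f x < f y} := by grind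
  have hcard := Finset.card_le_card hbelow
  have hsum := Finset.card_filter_add_card_filter_not (s := s) fun y => f x < f y
  grind

variable {V : Type*} [LinearOrder V] [Fintype V] {G : SimpleGraph V} {k : ℕ} {a b c : V}

open Classical in
/-- The edges of `G` that cross the chord `ab` when the vertices are placed on a circle in
increasing order, as pairs with the smaller end first. This is meant for `a < b`. -/
noncomputable def chordCrossings (G : SimpleGraph V) (a b : V) : Finset (V × V) :=
  {x | G.Adj x.1 x.2 ∧ (a < x.1 ∧ x.1 < b ∧ b < x.2 ∨ x.1 < a ∧ a < x.2 ∧ x.2 < b)}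

open Classical in
/-- The edges of `G` other than `ab` that join `[a, c)` to `(c, b]`, as pairs with the smaller end
first: for `a < c < b` these are the edges other than `ab` that separate `c` from the chord `ab`. -/
noncomputable def edgesOver (G : SimpleGraph V) (a c b : V) : Finset (V × V) :=
  {x | G.Adj x.1 x.2 ∧ a ≤ x.1 ∧ x.1 < c ∧ c < x.2 ∧ x.2 ≤ b ∧ x ≠ (a, b)}

/-- The vertices of `G`, placed on a circle in increasing order, form a min-`k`-planar drawing: of
two crossing edges, one is crossed at most `k` times. -/
def IsOuterMinPlanar (G : SimpleGraph V) (k : ℕ) : Prop :=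
  ∀ a b, a < b → G.Adj a b → ∀ x ∈ chordCrossings G a b,
    #(chordCrossings G a b) ≤ k ∨ #(chordCrossings G x.1 x.2) ≤ k

theorem mem_chordCrossings {x : V × V} : x ∈ chordCrossings G a b ↔
    G.Adj x.1 x.2 ∧ (a < x.1 ∧ x.1 < b ∧ b < x.2 ∨ x.1 < a ∧ a < x.2 ∧ x.2 < b) := by
  simp [chordCrossings]

theorem fst_lt_snd_of_mem_chordCrossings {x : V × V} (hx : x ∈ chordCrossings G a b) :
    x.1 < x.2 := by
  grind [mem_chordCrossings]

theorem mem_edgesOver {x : V × V} : x ∈ edgesOver G a c b ↔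
    G.Adj x.1 x.2 ∧ a ≤ x.1 ∧ x.1 < c ∧ c < x.2 ∧ x.2 ≤ b ∧ x ≠ (a, b) := by
  simp [edgesOver]

theorem card_chordCrossings_left_le (hcb : c < b) :
    #(chordCrossings G a c) ≤
      #(chordCrossings G a b ∩ chordCrossings G a c) + #(edgesOver G a c b) := by
  refine (Finset.card_le_card fun x hx => ?_).trans (Finset.card_union_le _ _)
  simp only [Finset.mem_union, Finset.mem_inter, mem_chordCrossings, mem_edgesOver] at hx ⊢
  grind

theorem card_chordCrossings_right_le (hac : a < c) :
    #(chordCrossings G c b) ≤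
      #(chordCrossings G a b ∩ chordCrossings G c b) + #(edgesOver G a c b) := by
  refine (Finset.card_le_card fun x hx => ?_).trans (Finset.card_union_le _ _)
  simp only [Finset.mem_union, Finset.mem_inter, mem_chordCrossings, mem_edgesOver] at hx ⊢
  grind

theorem chordCrossings_inter_left_subset {d : V} (hcd : c ≤ d) (hdb : d < b) :
    chordCrossings G a b ∩ chordCrossings G a c ⊆
      chordCrossings G a b ∩ chordCrossings G a d := by
  intro x hx
  simp only [Finset.mem_inter, mem_chordCrossings] at hx ⊢
  grind

theorem chordCrossings_inter_right_subset {d : V} (hac : a < c) (hcd : c ≤ d) :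
    chordCrossings G a b ∩ chordCrossings G d b ⊆
      chordCrossings G a b ∩ chordCrossings G c b := by
  intro x hx
  simp only [Finset.mem_inter, mem_chordCrossings] at hx ⊢
  grind

theorem IsOuterMinPlanar.card_le_or (hG : IsOuterMinPlanar G k) (hab : a < b) (hadj : G.Adj a b)
    {s : Finset (V × V)} (hs : s ⊆ chordCrossings G a b) :
    #s ≤ k ∨ ∀ x ∈ s, #(chordCrossings G x.1 x.2) ≤ k := by
  by_cases hk : #(chordCrossings G a b) ≤ k
  · exact .inl ((Finset.card_le_card hs).trans hk)
  · exact .inr fun x hx => (hG a b hab hadj x (hs hx)).resolve_left hk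

theorem exists_adj_edgesOver_subset_chordCrossings (hac : a < c) (hcb : c < b)
    (hadj : G.Adj a c) :
    ∃ d, c ≤ d ∧ d < b ∧ G.Adj a d ∧ edgesOver G a d b ⊆ chordCrossings G a d := by
  classical
  obtain ⟨d, hcd, hmax⟩ := Finset.exists_le_maximal {v : V | v < b ∧ G.Adj a v}.toFinset
    (a := c) (by simp [hcb, hadj])
  have hd : d < b ∧ G.Adj a d := by simpa using hmax.prop
  refine ⟨d, hcd, hd.1, hd.2, fun x hx => ?_⟩
  have hfarthest : d < x.2 → x.2 < b → ¬G.Adj a x.2 := fun hdx hxb hax =>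
    hmax.not_prop_of_gt hdx (by simp [hxb, hax])
  rw [mem_edgesOver] at hx
  rw [mem_chordCrossings]
  grind

theorem exists_median_chordCrossings (hX : (chordCrossings G a b).Nonempty) :
    ∃ p ∈ Set.Ioo a b, (∃ x ∈ chordCrossings G a b, x.1 = p ∨ x.2 = p) ∧
      2 * #(chordCrossings G a b ∩ chordCrossings G a p) ≤ #(chordCrossings G a b) ∧
      2 * #(chordCrossings G a b ∩ chordCrossings G p b) ≤ #(chordCrossings G a b) := by
  let innerEnd (x : V × V) : V := if a < x.1 then x.1 else x.2
  obtain ⟨x, hx, hleft, hright⟩ := exists_median hX innerEnd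
  have hx' := mem_chordCrossings.1 hx
  refine ⟨innerEnd x, by grind, ⟨x, hx, by grind⟩,
    hleft.trans' (Nat.mul_le_mul_left 2 (Finset.card_le_card fun y hy => ?_)),
    hright.trans' (Nat.mul_le_mul_left 2 (Finset.card_le_card fun y hy => ?_))⟩ <;>
  · simp only [Finset.mem_inter, Finset.mem_filter, mem_chordCrossings] at hy ⊢
    grind

theorem edgesOver_subset_chordCrossings {x : V × V} (hx : x ∈ chordCrossings G a b)
    (hc : c ∈ Set.Ioo a b) (hxc : x.1 = c ∨ x.2 = c) :
    edgesOver G a c b ⊆ chordCrossings G x.1 x.2 := by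
  intro y hy
  rw [mem_chordCrossings] at hx ⊢
  rw [mem_edgesOver] at hy
  grind

theorem IsOuterMinPlanar.exists_card_chordCrossings_inter_le (hG : IsOuterMinPlanar G k)
    (hab : (Set.Ioo a b).Nonempty) (hX : #(chordCrossings G a b) ≤ 2 * k) :
    ∃ p ∈ Set.Ioo a b, #(chordCrossings G a b ∩ chordCrossings G a p) ≤ k ∧
      #(chordCrossings G a b ∩ chordCrossings G p b) ≤ k ∧
      (#(edgesOver G a p b) ≤ k ∨ ∀ x ∈ edgesOver G a p b, #(chordCrossings G x.1 x.2) ≤ k) := by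
  rcases (chordCrossings G a b).eq_empty_or_nonempty with hempty | hne
  · simp only [hempty, Finset.empty_inter, Finset.card_empty, zero_le, true_and]
    by_cases hnbr : ∃ v ∈ Set.Ioo a b, G.Adj a v
    · obtain ⟨v, ⟨hav, hvb⟩, hadj⟩ := hnbr
      obtain ⟨d, hvd, hdb, had, hsub⟩ := exists_adj_edgesOver_subset_chordCrossings hav hvb hadj
      exact ⟨d, ⟨hav.trans_le hvd, hdb⟩, hG.card_le_or (hav.trans_le hvd) had hsub⟩
    · obtain ⟨p, hp⟩ := (Set.toFinite (Set.Ioo a b)).exists_minimal hab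
      refine ⟨p, hp.prop, .inr fun x hx => (hnbr ⟨x.2, ?_⟩).elim⟩
      have hfirst : x.1 < p → x.1 ∉ Set.Ioo a b := hp.not_prop_of_lt
      rw [mem_edgesOver] at hx
      grind [hp.prop]
  · obtain ⟨p, hp, ⟨x, hx, hxp⟩, hleft, hright⟩ := exists_median_chordCrossings hne
    have hlt := fst_lt_snd_of_mem_chordCrossings hx
    exact ⟨p, hp, by lia, by lia, hG.card_le_or hlt (mem_chordCrossings.1 hx).1
      (edgesOver_subset_chordCrossings hx hp hxp)⟩

theorem exists_apex_of_mem_edgesOver {p v : V} (hp : p ∈ Set.Ioo a b)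
    (hright : #(chordCrossings G a b ∩ chordCrossings G p b) ≤ k)
    (hlight : ∀ x ∈ edgesOver G a p b, #(chordCrossings G x.1 x.2) ≤ k)
    (hv : (a, v) ∈ edgesOver G a p b) :
    ∃ c ∈ Set.Ioo a b, #(edgesOver G a c b) ≤ k ∧
      #(chordCrossings G a c) ≤ 2 * k ∧ #(chordCrossings G c b) ≤ 2 * k := by
  obtain ⟨hav, -, -, hpv, hvb, hne⟩ := mem_edgesOver.1 hv
  obtain ⟨d, hvd, hdb, had, hsub⟩ := exists_adj_edgesOver_subset_chordCrossings
    (hp.1.trans hpv) (show v < b by grind) hav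
  have hpd : p < d := hpv.trans_le hvd
  have hd : #(chordCrossings G a d) ≤ k :=
    hlight (a, d) (mem_edgesOver.2 ⟨had, le_rfl, hp.1, hpd, hdb.le, by grind⟩)
  have hover : #(edgesOver G a d b) ≤ k := (Finset.card_le_card hsub).trans hd
  refine ⟨d, ⟨hp.1.trans hpd, hdb⟩, hover, by omega, ?_⟩
  grw [card_chordCrossings_right_le (hp.1.trans hpd),
    chordCrossings_inter_right_subset hp.1 hpd.le, hright, hover, two_mul]

theorem exists_apex_of_forall_notMem_edgesOver {p : V} (hp : p ∈ Set.Ioo a b)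
    (hleft : #(chordCrossings G a b ∩ chordCrossings G a p) ≤ k)
    (hright : #(chordCrossings G a b ∩ chordCrossings G p b) ≤ k)
    (hlight : ∀ x ∈ edgesOver G a p b, #(chordCrossings G x.1 x.2) ≤ k)
    (hne : (edgesOver G a p b).Nonempty) (ha : ∀ v, (a, v) ∉ edgesOver G a p b) :
    ∃ c ∈ Set.Ioo a b, #(edgesOver G a c b) ≤ k ∧
      #(chordCrossings G a c) ≤ 2 * k ∧ #(chordCrossings G c b) ≤ 2 * k := by
  obtain ⟨⟨c, q⟩, hcq, hmin⟩ := Finset.exists_min_image _ Prod.fst hne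
  have hk : #(chordCrossings G c q) ≤ k := hlight _ hcq
  have hac : a < c := (mem_edgesOver.1 hcq).2.1.lt_of_ne fun h => ha q (h ▸ hcq)
  have hcp : c < p := (mem_edgesOver.1 hcq).2.2.1
  have hleftmost {x : V × V} (hx : x ∈ edgesOver G a p b) : c ≤ x.1 := hmin x hx
  have hover : edgesOver G a c b ⊆ chordCrossings G c q := fun x hx => by
    have := @hleftmost x
    simp only [mem_edgesOver, mem_chordCrossings] at *
    grind
  have hcb : chordCrossings G c b ⊆
      chordCrossings G c q ∪ chordCrossings G a b ∩ chordCrossings G p b := fun x hx => by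
    have := @hleftmost x
    simp only [Finset.mem_union, Finset.mem_inter, mem_edgesOver, mem_chordCrossings] at *
    grind
  refine ⟨c, ⟨hac, hcp.trans hp.2⟩, (Finset.card_le_card hover).trans hk, ?_, ?_⟩
  · grw [card_chordCrossings_left_le (hcp.trans hp.2),
      chordCrossings_inter_left_subset hcp.le hp.2, hleft, hover, hk, two_mul]
  · grw [hcb, Finset.card_union_le, hk, hright, two_mul]

theorem IsOuterMinPlanar.exists_apex (hG : IsOuterMinPlanar G k) (hab : (Set.Ioo a b).Nonempty)
    (hX : #(chordCrossings G a b) ≤ 2 * k) :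
    ∃ c ∈ Set.Ioo a b, #(edgesOver G a c b) ≤ k ∧
      #(chordCrossings G a c) ≤ 2 * k ∧ #(chordCrossings G c b) ≤ 2 * k := by
  obtain ⟨p, hp, hleft, hright, hp'⟩ := hG.exists_card_chordCrossings_inter_le hab hX
  by_cases hover : #(edgesOver G a p b) ≤ k
  · refine ⟨p, hp, hover, ?_, ?_⟩
    · grw [card_chordCrossings_left_le hp.2, hleft, hover, two_mul]
    · grw [card_chordCrossings_right_le hp.1, hright, hover, two_mul]
  have hlight := hp'.resolve_left hover
  by_cases hnbr : ∃ v, (a, v) ∈ edgesOver G a p b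
  · exact exists_apex_of_mem_edgesOver hp hright hlight hnbr.choose_spec
  · exact exists_apex_of_forall_notMem_edgesOver hp hleft hright hlight
      (Finset.card_pos.1 (by omega)) (not_exists.1 hnbr)

/-- A set of vertices separating the vertices in `[a, b]` from the other ones: it consists of `a`,
`b` and one end of each edge that crosses the chord `ab`. -/
noncomputable def chordSeparator (G : SimpleGraph V) (a b : V) : Finset V :=
  {a, b} ∪ (chordCrossings G a b).image Prod.fst

/-- The side of the separation along the chord `ab` that contains `[a, b]`. -/
def chordSide (G : SimpleGraph V) (a b : V) : Set V :=
  Set.Icc a b ∪ chordSeparator G a b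

/-- The bag of the triangle `acb` in the recursive tree decomposition: the separator of the chord
`ab`, the vertex `c`, and the smaller ends of the edges that separate `c` from `ab`. -/
noncomputable def triangleBag (G : SimpleGraph V) (a c b : V) : Finset V :=
  insert c (chordSeparator G a b ∪ (edgesOver G a c b).image Prod.fst)

theorem mem_chordSeparator {v : V} : v ∈ chordSeparator G a b ↔
    v = a ∨ v = b ∨ ∃ w, (v, w) ∈ chordCrossings G a b := by
  simp [chordSeparator]

theorem mem_triangleBag {v : V} : v ∈ triangleBag G a c b ↔
    v = c ∨ v ∈ chordSeparator G a b ∨ ∃ w, (v, w) ∈ edgesOver G a c b := by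
  simp [triangleBag]

theorem card_chordSeparator_le : #(chordSeparator G a b) ≤ #(chordCrossings G a b) + 2 := by
  grw [chordSeparator, Finset.card_union_le, Finset.card_le_two, Finset.card_image_le, add_comm]

theorem card_triangleBag_le :
    #(triangleBag G a c b) ≤ #(chordCrossings G a b) + #(edgesOver G a c b) + 3 := by
  grw [triangleBag, Finset.card_insert_le, Finset.card_union_le, card_chordSeparator_le,
    Finset.card_image_le]
  omega

theorem chordSeparator_left_subset (hc : c ∈ Set.Ioo a b) :
    chordSeparator G a c ⊆ triangleBag G a c b := by
  intro v
  simp only [mem_triangleBag, mem_chordSeparator, mem_chordCrossings, mem_edgesOver]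
  grind

theorem chordSeparator_right_subset (hc : c ∈ Set.Ioo a b) :
    chordSeparator G c b ⊆ triangleBag G a c b := by
  intro v
  simp only [mem_triangleBag, mem_chordSeparator, mem_chordCrossings, mem_edgesOver]
  grind

theorem triangleBag_inter_chordSide_left_subset (hc : c ∈ Set.Ioo a b) :
    ↑(triangleBag G a c b) ∩ chordSide G a c ⊆ chordSeparator G a c := by
  rintro v ⟨hv, hv' | hv'⟩
  · simp only [SetLike.mem_coe, mem_triangleBag, mem_chordSeparator, mem_chordCrossings,
      mem_edgesOver] at hv ⊢
    grind
  · exact hv'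

theorem union_inter_chordSide_right_subset (hc : c ∈ Set.Ioo a b) :
    (↑(triangleBag G a c b) ∪ chordSide G a c) ∩ chordSide G c b ⊆ chordSeparator G c b := by
  rintro v ⟨hv, hv' | hv'⟩
  · simp only [chordSide, Set.mem_union, SetLike.mem_coe, mem_triangleBag, mem_chordSeparator,
      mem_chordCrossings, mem_edgesOver] at hv ⊢
    grind
  · exact hv'

theorem triangleBag_subset_chordSide (hc : c ∈ Set.Ioo a b) :
    ↑(triangleBag G a c b) ⊆ chordSide G a b := by
  intro v hv
  simp only [SetLike.mem_coe, mem_triangleBag, mem_edgesOver] at hv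
  simp only [chordSide, Set.mem_union, SetLike.mem_coe]
  grind

theorem chordSide_eq_union (hc : c ∈ Set.Ioo a b) :
    chordSide G a b = ↑(triangleBag G a c b) ∪ chordSide G a c ∪ chordSide G c b := by
  refine Set.Subset.antisymm ?_ (Set.union_subset (Set.union_subset ?_ ?_) ?_)
  · rintro v (hv | hv)
    · rcases le_total v c with hvc | hcv
      · exact .inl (.inr (.inl ⟨hv.1, hvc⟩))
      · exact .inr (.inl ⟨hcv, hv.2⟩)
    · exact .inl (.inl (mem_triangleBag.2 (.inr (.inl hv))))
  · exact triangleBag_subset_chordSide hc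
  · exact Set.union_subset ((Set.Icc_subset_Icc_right hc.2.le).trans Set.subset_union_left)
      ((Finset.coe_subset.2 (chordSeparator_left_subset hc)).trans
        (triangleBag_subset_chordSide hc))
  · exact Set.union_subset ((Set.Icc_subset_Icc_left hc.1.le).trans Set.subset_union_left)
      ((Finset.coe_subset.2 (chordSeparator_right_subset hc)).trans
        (triangleBag_subset_chordSide hc))

theorem not_adj_of_notMem_chordSide {u v : V} (hu : u ∉ chordSide G a b) (hv : v ∈ chordSide G a b)
    (hv' : v ∉ chordSeparator G a b) : ¬G.Adj u v := by
  intro huv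
  obtain ⟨hav, hvb⟩ : v ∈ Set.Icc a b := hv.resolve_right hv'
  replace hav : a < v := hav.lt_of_ne' fun h => hv' (mem_chordSeparator.2 (.inl h))
  replace hvb : v < b := hvb.lt_of_ne fun h => hv' (mem_chordSeparator.2 (.inr (.inl h)))
  obtain hua | hbu : u < a ∨ b < u := by
    by_contra! h
    exact hu (.inl h)
  · exact hu (.inr (mem_chordSeparator.2 (.inr (.inr
      ⟨v, mem_chordCrossings.2 ⟨huv, .inr ⟨hua, hav, hvb⟩⟩⟩))))
  · exact hv' (mem_chordSeparator.2 (.inr (.inr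
      ⟨u, mem_chordCrossings.2 ⟨huv.symm, .inl ⟨hav, hvb, hbu⟩⟩⟩)))

theorem IsOuterMinPlanar.hasRootedTreeDecompositionOn_chordSide {a b : V}
    (hG : IsOuterMinPlanar G k) (hX : #(chordCrossings G a b) ≤ 2 * k) :
    HasRootedTreeDecompositionOn G (chordSide G a b) (chordSeparator G a b) (3 * k + 3) := by
  have hcard := card_chordSeparator_le (G := G) (a := a) (b := b)
  rcases (Set.Ioo a b).eq_empty_or_nonempty with hempty | hne
  · have hside : chordSide G a b = chordSeparator G a b := by
      refine Set.union_eq_right.2 fun v hv => mem_chordSeparator.2 ?_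
      have : v ∉ Set.Ioo a b := hempty ▸ Set.notMem_empty v
      grind
    exact hside ▸ .of_card_le G (by omega)
  · obtain ⟨c, hc, hover, hac, hcb⟩ := hG.exists_apex hne hX
    have hbag : #(triangleBag G a c b) ≤ 3 * k + 3 :=
      card_triangleBag_le.trans (by omega)
    have hleft := hG.hasRootedTreeDecompositionOn_chordSide hac
    have hright := hG.hasRootedTreeDecompositionOn_chordSide hcb
    have hsub := chordSeparator_left_subset (G := G) hc
    have hsub' := chordSeparator_right_subset (G := G) hc
    rw [chordSide_eq_union hc]
    have hinter := triangleBag_inter_chordSide_left_subset (G := G) hc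
    have hinter' := union_inter_chordSide_right_subset (G := G) hc
    refine (((HasRootedTreeDecompositionOn.of_card_le G hbag).union hleft
      Set.inter_subset_left hinter ?_).union hright
      (hinter'.trans (Finset.coe_subset.2 hsub')) hinter' ?_).mono_root ?_
    · exact fun u hu v hv => not_adj_of_notMem_chordSide hu.2 hv.1 fun h => hv.2 (hsub h)
    · exact fun u hu v hv => not_adj_of_notMem_chordSide hu.2 hv.1 fun h => hv.2 (.inl (hsub' h))
    · exact Finset.subset_union_left.trans (Finset.subset_insert _ _)
termination_by (Set.Ioo a b).ncard
decreasing_by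
  · have hsub : Set.Ioo a c ⊆ Set.Ioo a b := Set.Ioo_subset_Ioo_right hc.2.le
    exact Set.ncard_lt_ncard ((Set.ssubset_iff_of_subset hsub).2 ⟨c, hc, by simp⟩)
  · have hsub : Set.Ioo c b ⊆ Set.Ioo a b := Set.Ioo_subset_Ioo_left hc.1.le
    exact Set.ncard_lt_ncard ((Set.ssubset_iff_of_subset hsub).2 ⟨c, hc, by simp⟩)

theorem IsOuterMinPlanar.treeWidth_le (hG : IsOuterMinPlanar G k) : treeWidth G ≤ 3 * k + 2 := by
  rcases isEmpty_or_nonempty V with hV | hV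
  · have hempty := HasRootedTreeDecompositionOn.of_card_le G (R := ∅) (m := 3 * k + 3) (by simp)
    rw [Finset.coe_empty, ← Set.univ_eq_empty_iff.2 hV] at hempty
    exact_mod_cast hempty.treeWidth_le
  · obtain ⟨a, ha⟩ : ∃ a : V, ∀ v, a ≤ v := Finite.exists_min id
    obtain ⟨b, hb⟩ : ∃ b : V, ∀ v, v ≤ b := Finite.exists_max id
    have hX : chordCrossings G a b = ∅ := by
      simp [chordCrossings, (ha _).not_gt, (hb _).not_gt]
    have hside : chordSide G a b = Set.univ :=
      Set.eq_univ_of_forall fun v => .inl ⟨ha v, hb v⟩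
    have hroot := hG.hasRootedTreeDecompositionOn_chordSide (a := a) (b := b) (by simp [hX])
    rw [hside] at hroot
    exact_mod_cast hroot.treeWidth_le

end ConvexDrawing

section Geometry

/-- Twice the signed area of the triangle `pqr`: positive if `p`, `q`, `r` run counterclockwise. -/
def signedArea (p q r : Plane) : ℝ :=
  (q 0 - p 0) * (r 1 - p 1) - (q 1 - p 1) * (r 0 - p 0)

/-- The point at angle `θ` on the circle with centre `o` and radius `R`. -/
noncomputable def circlePoint (o : Plane) (R θ : ℝ) : Plane :=
  !₂[o 0 + R * Real.cos θ, o 1 + R * Real.sin θ]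

/-- The vertices, taken in increasing order, run counterclockwise around a convex polygon. -/
def IsCounterclockwise {V : Type*} [LinearOrder V] (pos : V → Plane) : Prop :=
  ∀ a b c, a < b → b < c → 0 < signedArea (pos a) (pos b) (pos c)

theorem segment_inter_segment_nonempty_of_signedArea_pos {p q r s : Plane}
    (hqrs : 0 < signedArea q r s) (hprs : 0 < signedArea p r s)
    (hpqs : 0 < signedArea p q s) (hpqr : 0 < signedArea p q r) :
    (segment ℝ p r ∩ segment ℝ q s).Nonempty := by
  have hsum : signedArea q r s + signedArea p q s = signedArea p r s + signedArea p q r := by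
    unfold signedArea; ring
  set t := signedArea q r s + signedArea p q s with ht
  have ht0 : 0 < t := by positivity
  -- The diagonals cut each other in the ratios of the areas of the triangles on either side.
  refine ⟨(signedArea q r s / t) • p + (signedArea p q s / t) • r,
    ⟨_, _, by positivity, by positivity, by field_simp; exact ht.symm, rfl⟩,
    ⟨signedArea p r s / t, signedArea p q r / t, by positivity, by positivity,
      by field_simp; exact hsum.symm, ?_⟩⟩
  ext i
  simp only [PiLp.add_apply, PiLp.smul_apply, smul_eq_mul]
  field_simp
  unfold signedArea
  fin_cases i <;> simp <;> ring

theorem IsCounterclockwise.segment_inter_segment_nonempty {V : Type*} [LinearOrder V]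
    {pos : V → Plane} (hpos : IsCounterclockwise pos) {a b c d : V} (hab : a < b) (hbc : b < c)
    (hcd : c < d) : (segment ℝ (pos a) (pos c) ∩ segment ℝ (pos b) (pos d)).Nonempty :=
  segment_inter_segment_nonempty_of_signedArea_pos (hpos b c d hbc hcd)
    (hpos a c d (hab.trans hbc) hcd) (hpos a b d hab (hbc.trans hcd)) (hpos a b c hab hbc)

theorem sin_sub_add_sin_sub_sub_sin_sub (α β γ : ℝ) :
    Real.sin (β - α) + Real.sin (γ - β) - Real.sin (γ - α) =
      4 * Real.sin ((β - α) / 2) * Real.sin ((γ - β) / 2) * Real.sin ((γ - α) / 2) := by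
  obtain ⟨x, hx⟩ : ∃ x, β - α = 2 * x := ⟨(β - α) / 2, by ring⟩
  obtain ⟨y, hy⟩ : ∃ y, γ - β = 2 * y := ⟨(γ - β) / 2, by ring⟩
  have hxy : γ - α = 2 * (x + y) := by linarith
  simp only [hx, hy, hxy, mul_div_cancel_left₀ _ (two_ne_zero' ℝ), Real.sin_two_mul,
    Real.sin_add, Real.cos_add]
  linear_combination
    (-2 * Real.sin x * Real.cos x) * Real.sin_sq_add_cos_sq y
      + (-2 * Real.sin y * Real.cos y) * Real.sin_sq_add_cos_sq x

theorem signedArea_circlePoint (o : Plane) (R α β γ : ℝ) :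
    signedArea (circlePoint o R α) (circlePoint o R β) (circlePoint o R γ) =
      4 * R ^ 2 *
        (Real.sin ((β - α) / 2) * Real.sin ((γ - β) / 2) * Real.sin ((γ - α) / 2)) := by
  have hsum := sin_sub_add_sin_sub_sub_sin_sub α β γ
  simp only [Real.sin_sub] at hsum
  simp only [signedArea, circlePoint, PiLp.toLp_apply, Matrix.cons_val_zero, Matrix.cons_val_one]
  linear_combination R ^ 2 * hsum

theorem signedArea_circlePoint_pos {o : Plane} {R α β γ : ℝ} (hR : R ≠ 0)
    (hαβ : α < β) (hβγ : β < γ) (hγα : γ - α < 2 * Real.pi) :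
    0 < signedArea (circlePoint o R α) (circlePoint o R β) (circlePoint o R γ) := by
  have sin_half_pos {θ : ℝ} (h0 : 0 < θ) (h1 : θ < 2 * Real.pi) : 0 < Real.sin (θ / 2) :=
    Real.sin_pos_of_pos_of_lt_pi (by linarith) (by linarith)
  rw [signedArea_circlePoint]
  have := sin_half_pos (θ := β - α) (by linarith) (by linarith)
  have := sin_half_pos (θ := γ - β) (by linarith) (by linarith)
  have := sin_half_pos (θ := γ - α) (by linarith) hγα
  positivity

theorem exists_circlePoint_eq {o p : Plane} {R : ℝ} (hp : dist p o = R) :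
    ∃ θ ∈ Set.Ioc (-Real.pi) Real.pi, circlePoint o R θ = p := by
  set z : ℂ := ⟨p 0 - o 0, p 1 - o 1⟩
  have hz : ‖z‖ = R := by
    rw [← hp, EuclideanSpace.dist_eq, Complex.norm_eq_sqrt_sq_add_sq, Fin.sum_univ_two,
      Real.dist_eq, Real.dist_eq, sq_abs, sq_abs]
  refine ⟨z.arg, z.arg_mem_Ioc, ?_⟩
  ext i
  fin_cases i
  · simp [circlePoint, ← hz, Complex.norm_mul_cos_arg, z]
  · simp [circlePoint, ← hz, Complex.norm_mul_sin_arg, z]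

theorem exists_isCounterclockwise {V : Type*} {pos : V → Plane}
    (hinj : Function.Injective pos) (hpos : EuclideanGeometry.Cospherical (Set.range pos)) :
    ∃ _ : LinearOrder V, IsCounterclockwise pos := by
  obtain ⟨o, R, hR⟩ := hpos
  choose θ hθ hpos using fun v => exists_circlePoint_eq (hR (pos v) ⟨v, rfl⟩)
  have hθinj : Function.Injective θ := fun u v huv => hinj (by rw [← hpos u, ← hpos v, huv])
  let := LinearOrder.lift' θ hθinj
  refine ⟨this, fun a b c hab hbc => ?_⟩
  have hR0 : R ≠ 0 := by
    rintro rfl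
    have hcentre : ∀ v, pos v = o := fun v => dist_eq_zero.1 (hR _ ⟨v, rfl⟩)
    exact hab.ne (hinj ((hcentre a).trans (hcentre b).symm))
  rw [← hpos a, ← hpos b, ← hpos c]
  exact signedArea_circlePoint_pos hR0 hab hbc (by linarith [(hθ a).1, (hθ c).2])

end Geometry

namespace RectilinearDrawing

variable {V : Type*} {G : SimpleGraph V} {Γ : RectilinearDrawing G}

theorem Crosses.symm {e f : Sym2 V} (h : Γ.Crosses e f) : Γ.Crosses f e := by
  obtain ⟨he, hf, hne, x, hx, hend⟩ := h
  exact ⟨hf, he, hne.symm, x, hx.symm, fun v hvf hve => hend v hve hvf⟩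

variable [LinearOrder V]

theorem crosses_of_lt_of_lt_of_lt (hpos : IsCounterclockwise Γ.pos) {a b c d : V} (hab : a < b)
    (hbc : b < c) (hcd : c < d) (hac : G.Adj a c) (hbd : G.Adj b d) :
    Γ.Crosses s(a, c) s(b, d) := by
  have hdisj : ∀ v ∈ s(a, c), v ∉ s(b, d) := by
    simp only [Sym2.mem_iff]
    grind
  refine ⟨hac, hbd, fun h => hdisj a (by simp) (h ▸ by simp), ?_⟩
  obtain ⟨x, hx⟩ := hpos.segment_inter_segment_nonempty hab hbc hcd
  exact ⟨x, hx, fun v hve hvf => (hdisj v hve hvf).elim⟩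

variable [Fintype V] {k : ℕ} {a b : V}

theorem crosses_of_mem_chordCrossings (hpos : IsCounterclockwise Γ.pos) (hadj : G.Adj a b)
    {x : V × V} (hx : x ∈ chordCrossings G a b) : Γ.Crosses s(a, b) s(x.1, x.2) := by
  obtain ⟨hx, ⟨hax, hxb, hbx⟩ | ⟨hxa, hax, hxb⟩⟩ := mem_chordCrossings.1 hx
  · exact crosses_of_lt_of_lt_of_lt hpos hax hxb hbx hadj hx
  · exact (crosses_of_lt_of_lt_of_lt hpos hxa hax hxb hx hadj).symm

theorem card_chordCrossings_le (hpos : IsCounterclockwise Γ.pos)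
    (hadj : G.Adj a b) : (chordCrossings G a b).card ≤ (Γ.crossedEdges s(a, b)).ncard := by
  rw [← Set.ncard_coe_finset]
  refine Set.ncard_le_ncard_of_injOn (fun x => s(x.1, x.2))
    (fun x hx => crosses_of_mem_chordCrossings hpos hadj hx) (fun x hx y hy hxy => ?_)
  have hxlt := fst_lt_snd_of_mem_chordCrossings hx
  have hylt := fst_lt_snd_of_mem_chordCrossings hy
  rcases Sym2.mk_eq_mk_iff.1 hxy with h | h
  · exact h
  · grind

theorem isOuterMinPlanar (hpos : IsCounterclockwise Γ.pos)
    (hk : ∀ e f : Sym2 V, Γ.Crosses e f →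
      (Γ.crossedEdges e).ncard ≤ k ∨ (Γ.crossedEdges f).ncard ≤ k) : IsOuterMinPlanar G k := by
  intro a b _ hadj x hx
  have hxadj := (mem_chordCrossings.1 hx).1
  exact (hk _ _ (crosses_of_mem_chordCrossings hpos hadj hx)).imp
    (card_chordCrossings_le hpos hadj).trans (card_chordCrossings_le hpos hxadj).trans

end RectilinearDrawing

theorem mainTheorem10_general {V : Type*} [Finite V] (G : SimpleGraph V) (k : ℕ)
    (Γ : RectilinearDrawing G) (hΓ : Γ.IsConvex)
    (hk : ∀ e f : Sym2 V, Γ.Crosses e f →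
      (Γ.crossedEdges e).ncard ≤ k ∨ (Γ.crossedEdges f).ncard ≤ k) :
    treeWidth G ≤ 3 * (k : ℤ) + 2 := by
  have := Fintype.ofFinite V
  obtain ⟨_, hpos⟩ := exists_isCounterclockwise Γ.injective hΓ
  exact (RectilinearDrawing.isOuterMinPlanar hpos hk).treeWidth_le

theorem mainTheorem10 {V : Type*} [Finite V] (G : SimpleGraph V) (k : ℕ)
    (Γ : RectilinearDrawing G) (hΓ : Γ.IsConvex)
    (hk : ∀ e f : Sym2 V, Γ.Crosses e f →
      (Γ.crossedEdges e).ncard ≤ k ∨ (Γ.crossedEdges f).ncard ≤ k) :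
    treeWidth G ≤ 3 * (k : ℤ) + 11 :=
  (mainTheorem10_general G k Γ hΓ hk).trans (by lia)
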